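/- Let $m \ge s \ge 1$ be integers, $x = m/s$ and $n = \lfloor 2x \rfloor$ (so $n \ge 2$). In the supply-constrained muffin problem $(m,s)$, each of $m$ muffins of size $1$ is cut into exactly two pieces of positive size, and the $2m$ pieces are distributed to $s$ students so that each student receives total size $x$; the objective is to maximize the size of the smallest piece. The corresponding fully-constrained muffin problem has the same objective and the additional requirement that every student receives either $n$ or $n+1$ pieces. Then: 1. Every optimal solution of the fully-constrained problem is an optimal solution of the supply-constrained problem. 2. The supply-constrained problem has an optimal solution in which every student receives either $n$ or $n+1$ pieces. 3. The supply-constrained problem has an optimal solution that is not feasible for the fully-constrained problem if and only if $$\frac{n(n+2)}{2(n+1)} \le x < \frac{n+1}{2}.$$ -/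

import Mathlib

/-- A way of cutting each of `m` muffins into exactly two pieces, of positive size, and handing
the `2 * m` pieces to `s` students so that every student receives the same total `m / s`.
These are the feasible solutions of the supply-constrained muffin problem `(m, s)`. -/
structure MuffinSolution (m s : ℕ) where
  /-- `size i j` is the size of piece `j` of muffin `i`. -/
  size : Fin m → Fin 2 → ℝ
  /-- `student i j` is the student who receives piece `j` of muffin `i`. -/
  student : Fin m → Fin 2 → Fin s
  size_pos : ∀ i j, 0 < size i j
  sum_muffin : ∀ i, ∑ j, size i j = 1
  sum_student : ∀ k, (∑ i, ∑ j, if student i j = k then size i j else 0) = (m : ℝ) / (s : ℝ)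

namespace MuffinSolution

/-- The size of the smallest piece (a minimum over a finite set, nonempty when `0 < m`). -/
noncomputable def smallest {m s : ℕ} (D : MuffinSolution m s) : ℝ :=
  ⨅ p : Fin m × Fin 2, D.size p.1 p.2

/-- The number of pieces that student `k` receives. -/
def numPieces {m s : ℕ} (D : MuffinSolution m s) (k : Fin s) : ℕ :=
  (Finset.univ.filter fun p : Fin m × Fin 2 => D.student p.1 p.2 = k).card

/-- `D` is optimal for the supply-constrained muffin problem. -/
def SupplyOptimal {m s : ℕ} (D : MuffinSolution m s) : Prop :=
  ∀ E : MuffinSolution m s, E.smallest ≤ D.smallest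

/-- `D` is feasible for the fully-constrained muffin problem:
every student receives `n` or `n + 1` pieces, where `n = ⌊2 * m / s⌋`. -/
def FullyFeasible {m s : ℕ} (D : MuffinSolution m s) : Prop :=
  ∀ k, D.numPieces k = ⌊2 * ((m : ℝ) / (s : ℝ))⌋₊ ∨
    D.numPieces k = ⌊2 * ((m : ℝ) / (s : ℝ))⌋₊ + 1

/-- `D` is optimal for the fully-constrained muffin problem. -/
def FullyOptimal {m s : ℕ} (D : MuffinSolution m s) : Prop :=
  D.FullyFeasible ∧ ∀ E : MuffinSolution m s, E.FullyFeasible → E.smallest ≤ D.smallest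

end MuffinSolution

/-!
Measure each piece by its deviation from `1 / 2`. The two pieces of a muffin have opposite
deviations, so an allocation of pieces is a family of multisets of deviations whose union is
symmetric under negation. To construct one it suffices to prescribe a symmetric family that
completes some students and leaves the others two or more pieces short, with missing totals in an
interval `[L, L + 2 * C]`: the missing totals sum to zero, so in a suitable order they are the steps
of a closed walk that stays in an interval of length `2 * C`. A step from `a` to `a + t` is handed
out as two pieces with deviations `-a` and `a + t`, and leaving and reaching each position equally
often keeps the family symmetric.

Write `x = m / s`. Some student has at most `n` pieces, hence no solution beats `1 - x / n`. If
`n * (n + 2) / (2 * (n + 1)) ≤ x`, this bound is attained both with and without a student who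
receives `n + 2` pieces. If `x` is smaller, then a student with at least `n + 2` or at most `n - 1`
pieces forces a piece smaller than `n / (2 * (n + 1))`, a size that some fully feasible solution
keeps to; only `n = 2` needs the separate bound `x / 4`.
-/

section Flow

variable {κ 𝕜 : Type*} [Field 𝕜] [LinearOrder 𝕜] [IsStrictOrderedRing 𝕜] {A : Finset κ}
  {t : κ → 𝕜} {g L U C : 𝕜}

theorem exists_add_mem_Ico_of_add_sum_eq_zero (hA : A.Nonempty) (hg : g ∈ Set.Ico L U)
    (hsum : g + ∑ k ∈ A, t k = 0) (ht : ∀ k ∈ A, t k ∈ Set.Icc L U) :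
    ∃ k ∈ A, g + t k ∈ Set.Ico L U := by
  rcases le_or_gt 0 g with h0 | h0
  · obtain ⟨k, hk, hk0⟩ : ∃ k ∈ A, t k ≤ 0 :=
      Finset.exists_le_of_sum_le hA (by rw [Finset.sum_const_zero]; linarith)
    exact ⟨k, hk, by linarith [(ht k hk).1], by linarith [hg.2]⟩
  · obtain ⟨k, hk, hk0⟩ : ∃ k ∈ A, 0 ≤ t k :=
      Finset.exists_le_of_sum_le hA (by rw [Finset.sum_const_zero]; linarith)
    exact ⟨k, hk, by linarith [hg.1], by linarith [(ht k hk).2]⟩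

-- The value `a k` is the position from which the walk takes the step `t k`.
theorem exists_walk_mem_Ico (hg : g ∈ Set.Ico L U) (hsum : g + ∑ k ∈ A, t k = 0)
    (ht : ∀ k ∈ A, t k ∈ Set.Icc L U) :
    ∃ a : κ → 𝕜, (∀ k ∈ A, a k ∈ Set.Ico L U) ∧
      0 ::ₘ A.val.map a = g ::ₘ A.val.map fun k => a k + t k := by
  classical
  induction A using Finset.strongInduction generalizing g with
  | H A ih =>
    rcases A.eq_empty_or_nonempty with rfl | hA
    · exact ⟨0, by simp, by simpa using hsum.symm⟩
    · obtain ⟨k, hk, hgk⟩ := exists_add_mem_Ico_of_add_sum_eq_zero hA hg hsum ht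
      obtain ⟨a, ha, hmap⟩ := ih (A.erase k) (Finset.erase_ssubset hk) hgk
        (by rw [add_assoc, Finset.add_sum_erase A t hk, hsum])
        fun j hj => ht j (Finset.mem_of_mem_erase hj)
      have hne : ∀ j ∈ A.erase k, Function.update a k g j = a j := fun j hj =>
        Function.update_of_ne (Finset.ne_of_mem_erase hj) ..
      refine ⟨Function.update a k g, fun j hj => ?_, ?_⟩
      · rcases eq_or_ne j k with rfl | hjk
        · simpa using hg
        · rw [hne j (Finset.mem_erase.2 ⟨hjk, hj⟩)]
          exact ha j (Finset.mem_erase.2 ⟨hjk, hj⟩)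
      · rw [← Multiset.cons_erase hk, ← Finset.erase_val, Multiset.map_cons, Multiset.map_cons,
          Function.update_self, Multiset.map_congr rfl hne,
          Multiset.map_congr rfl fun j hj => congrArg (· + t j) (hne j hj),
          Multiset.cons_swap, hmap]

theorem exists_map_eq_map_add_abs_lt (hC : 0 < C) (hsum : ∑ k ∈ A, t k = 0)
    (ht : ∀ k ∈ A, t k ∈ Set.Icc L (L + 2 * C)) :
    ∃ a : κ → 𝕜, (A.val.map a = A.val.map fun k => a k + t k) ∧ ∀ k ∈ A, |a k| < C := by
  by_cases hzero : ∀ k ∈ A, t k = 0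
  · exact ⟨0, Multiset.map_congr rfl fun k hk => by simp [hzero k hk], by simp [hC]⟩
  have hA : A.Nonempty := by
    by_contra! hA
    exact hzero (by simp [hA])
  have hL : L ≤ 0 := by
    obtain ⟨k, hk, h⟩ := Finset.exists_le_of_sum_le hA (f := t) (g := 0) (by simp [hsum])
    exact (ht k hk).1.trans h
  have hU : 0 < L + 2 * C := by
    by_contra! hU
    exact hzero ((Finset.sum_eq_zero_iff_of_nonpos fun k hk => (ht k hk).2.trans hU).1 hsum)
  obtain ⟨a, ha, hmap⟩ := exists_walk_mem_Ico ⟨hL, hU⟩ (by rw [hsum, add_zero]) ht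
  obtain ⟨k₀, hk₀, hmax⟩ := A.exists_max_image a hA
  refine ⟨fun k => a k - (a k₀ + L) / 2, ?_, fun k hk => ?_⟩
  · have h := congrArg (Multiset.map (· - (a k₀ + L) / 2)) (Multiset.cons_inj_right _ |>.1 hmap)
    simp only [Multiset.map_map, Function.comp_def] at h
    simpa only [sub_add_eq_add_sub] using h
  · rw [abs_lt]
    constructor <;> linarith [(ha k hk).1, hmax k hk, (ha k₀ hk₀).2]

end Flow

section Balanced

variable {ι κ 𝕜 : Type*}

theorem multiset_map_finset_sum {α β : Type*} (f : α → β) (A : Finset ι) (F : ι → Multiset α) :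
    (∑ i ∈ A, F i).map f = ∑ i ∈ A, (F i).map f :=
  map_sum (Multiset.mapAddMonoidHom f) F A

variable [Fintype ι] [Fintype κ]

/-- A family of multisets, one for each student, is balanced when its values, counted over all
students together, can be matched into pairs of opposite values (up to one value `0`). Such a
family records the deviations of the pieces from `1 / 2`: the two pieces of a muffin deviate by
opposite amounts. -/
def IsBalanced [AddCommGroup 𝕜] (F : ι → Multiset 𝕜) : Prop :=
  (∑ i, F i).map Neg.neg = ∑ i, F i

namespace IsBalanced

theorem add [AddCommGroup 𝕜] {F G : ι → Multiset 𝕜} (hF : IsBalanced F) (hG : IsBalanced G) :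
    IsBalanced (F + G) := by
  simp only [IsBalanced, Pi.add_apply, Finset.sum_add_distrib, Multiset.map_add] at *
  rw [hF, hG]

theorem comp_equiv [AddCommGroup 𝕜] {F : ι → Multiset 𝕜} (hF : IsBalanced F) (e : κ ≃ ι) :
    IsBalanced (F ∘ e) := by
  simpa only [IsBalanced, Function.comp_def, Equiv.sum_comp e F] using hF

theorem of_map_eq_map_add [AddCommGroup 𝕜] [DecidableEq ι] {A : Finset ι} {a t : ι → 𝕜}
    (h : A.val.map a = A.val.map fun i => a i + t i) (c : ι → ℕ) :
    IsBalanced fun i =>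
      if i ∈ A then Multiset.replicate (c i) 0 + {-a i} + {a i + t i} else 0 := by
  have hsingle (f : ι → 𝕜) : ∑ i ∈ A, ({f i} : Multiset 𝕜) = A.val.map f := by
    rw [← Multiset.sum_map_singleton (A.val.map f), Multiset.map_map]
    rfl
  simp only [IsBalanced, Finset.sum_ite_mem, Finset.univ_inter, Finset.sum_add_distrib,
    Multiset.map_add, multiset_map_finset_sum, Multiset.map_replicate, neg_zero, neg_neg, hsingle,
    Multiset.map_map, Function.comp_def, ← h, add_assoc]
  rw [add_comm (A.val.map fun i => a i)]

variable [Field 𝕜] [LinearOrder 𝕜] [IsStrictOrderedRing 𝕜] {F G : ι → Multiset 𝕜}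

theorem sum_eq_zero (hF : IsBalanced F) : ∑ i, (F i).sum = 0 := by
  have h := congrArg Multiset.sum hF
  rw [Multiset.sum_map_neg', Multiset.sum_sum] at h
  exact self_eq_neg.1 h.symm

theorem exists_completion (hG : IsBalanced G) {deg : ι → ℕ} {need : ι → 𝕜} {L C : 𝕜}
    (hC : 0 < C) (hneed : ∑ i, need i = 0)
    (h : ∀ i, ((G i).card = deg i ∧ (G i).sum = need i) ∨
      ((G i).card + 2 ≤ deg i ∧ need i - (G i).sum ∈ Set.Icc L (L + 2 * C))) :
    ∃ H : ι → Multiset 𝕜, IsBalanced H ∧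
      ∀ i, (H i).card = deg i ∧ (H i).sum = need i ∧ ∀ d ∈ H i, d ∈ G i ∨ |d| < C := by
  classical
  set A : Finset ι := Finset.univ.filter fun i => (G i).card + 2 ≤ deg i with hA
  set t : ι → 𝕜 := fun i => need i - (G i).sum with ht
  have hcomplete : ∀ i ∉ A, (G i).card = deg i ∧ (G i).sum = need i := fun i hi =>
    (h i).resolve_right fun hi' => hi (by simp [hA, hi'.1])
  have hopen : ∀ i ∈ A, (G i).card + 2 ≤ deg i ∧ t i ∈ Set.Icc L (L + 2 * C) := fun i hi => by
    have hcard := (Finset.mem_filter.1 hi).2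
    exact (h i).resolve_left fun hi' => by omega
  have hsum : ∑ i ∈ A, t i = 0 := by
    rw [Finset.sum_subset A.subset_univ fun i _ hi => sub_eq_zero.2 (hcomplete i hi).2.symm,
      Finset.sum_sub_distrib, hneed, hG.sum_eq_zero, sub_zero]
  obtain ⟨a, hmap, ha⟩ := exists_map_eq_map_add_abs_lt hC hsum fun i hi => (hopen i hi).2
  have ha' : ∀ i ∈ A, |a i + t i| < C := fun i hi => by
    obtain ⟨j, hj, hji⟩ := Multiset.mem_map.1 (hmap ▸ Multiset.mem_map_of_mem _ hi :
      a i + t i ∈ A.val.map a)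
    exact hji ▸ ha j hj
  refine ⟨_, hG.add (of_map_eq_map_add hmap fun i => deg i - 2 - (G i).card), fun i => ?_⟩
  by_cases hi : i ∈ A
  · have hcard := (hopen i hi).1
    simp only [Pi.add_apply, if_pos hi]
    refine ⟨?_, by simp [ht], fun d hd => ?_⟩
    · simp only [Multiset.card_add, Multiset.card_replicate, Multiset.card_singleton]
      omega
    · simp only [Multiset.mem_add, Multiset.mem_replicate, Multiset.mem_singleton] at hd
      rcases hd with hd | (⟨-, rfl⟩ | rfl) | rfl
      · exact .inl hd
      · exact .inr (by simpa using hC)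
      · exact .inr (by simpa using ha i hi)
      · exact .inr (ha' i hi)
  · simpa [hi, hcomplete i hi] using fun d hd => Or.inl hd

end IsBalanced

end Balanced

section Pairing

theorem exists_sum_eq_of_mul_le_of_le_mul {N k l : ℕ} :
    ∀ {q : ℕ}, q * k ≤ N → N ≤ q * l → ∃ b : Fin q → ℕ, ∑ i, b i = N ∧ ∀ i, k ≤ b i ∧ b i ≤ l
  | 0, _, hl => ⟨0, by simp_all, fun i => i.elim0⟩
  | q + 1, hk, hl => by
    have hkl : k ≤ l := Nat.le_of_mul_le_mul_left (hk.trans hl) q.succ_pos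
    have hk' : q * k + k ≤ N := by rwa [← Nat.succ_mul]
    have hl' : N ≤ q * l + l := by rwa [← Nat.succ_mul]
    have hmul : q * k ≤ q * l := Nat.mul_le_mul_left q hkl
    obtain ⟨b, hsum, hb⟩ := exists_sum_eq_of_mul_le_of_le_mul (N := N - max k (N - q * l))
      (k := k) (l := l) (q := q) (by omega) (by omega)
    refine ⟨Fin.cons (max k (N - q * l)) b, ?_, Fin.cases ?_ (by simpa using hb)⟩
    · simp only [Fin.sum_univ_succ, Fin.cons_zero, Fin.cons_succ, hsum]
      omega
    · simp only [Fin.cons_zero]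
      omega

variable {β ι 𝕜 : Type*} [Field 𝕜] [LinearOrder 𝕜] [IsStrictOrderedRing 𝕜]

theorem exists_cons_cons_of_map_neg_eq {f : β → 𝕜} {M : Multiset β} (hM : 1 < M.card)
    (hneg : (M.map f).map Neg.neg = M.map f) :
    ∃ u v N, M = u ::ₘ v ::ₘ N ∧ f u + f v = 0 := by
  by_cases h : ∃ u ∈ M, f u ≠ 0
  · obtain ⟨u, hu, hu0⟩ := h
    obtain ⟨v, hv, hvu⟩ : ∃ v ∈ M, f v = -f u :=
      Multiset.mem_map.1 (hneg ▸ Multiset.mem_map_of_mem _ (Multiset.mem_map_of_mem f hu))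
    obtain ⟨N, rfl⟩ := Multiset.exists_cons_of_mem hu
    have hvne : v ≠ u := by
      rintro rfl
      exact hu0 (self_eq_neg.1 hvu)
    obtain ⟨N', rfl⟩ := Multiset.exists_cons_of_mem ((Multiset.mem_cons.1 hv).resolve_left hvne)
    exact ⟨u, v, N', rfl, by rw [hvu, add_neg_cancel]⟩
  · push Not at h
    obtain ⟨u, hu⟩ := Multiset.card_pos_iff_exists_mem.1 (zero_lt_one.trans hM)
    obtain ⟨N, rfl⟩ := Multiset.exists_cons_of_mem hu
    rw [Multiset.card_cons, Nat.lt_add_left_iff_pos] at hM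
    obtain ⟨v, hv⟩ := Multiset.card_pos_iff_exists_mem.1 hM
    obtain ⟨N', rfl⟩ := Multiset.exists_cons_of_mem hv
    exact ⟨u, v, N', rfl, by rw [h u (by simp), h v (by simp), add_zero]⟩

theorem exists_pairing_of_map_neg_eq (f : β → 𝕜) {m : ℕ} {M : Multiset β} (hM : M.card = 2 * m)
    (hneg : (M.map f).map Neg.neg = M.map f) :
    ∃ P : Fin m → Fin 2 → β, ∑ i, ∑ j, ({P i j} : Multiset β) = M ∧
      ∀ i, f (P i 0) + f (P i 1) = 0 := by
  induction m generalizing M with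
  | zero => exact ⟨fun i => i.elim0, by simp_all, fun i => i.elim0⟩
  | succ m ih =>
    obtain ⟨u, v, N, rfl, huv⟩ := exists_cons_cons_of_map_neg_eq (by omega) hneg
    have hneg' : (N.map f).map Neg.neg = N.map f := by
      simp only [Multiset.map_cons] at hneg
      rwa [neg_eq_of_add_eq_zero_right huv, neg_eq_of_add_eq_zero_left huv, Multiset.cons_swap,
        Multiset.cons_inj_right, Multiset.cons_inj_right] at hneg
    obtain ⟨P, hP, hP0⟩ := ih (by simp only [Multiset.card_cons] at hM; omega) hneg'
    refine ⟨Fin.cons ![u, v] P, ?_, Fin.cases (by simpa using huv) (by simpa using hP0)⟩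
    rw [Fin.sum_univ_succ]
    simp only [Fin.cons_zero, Fin.cons_succ, hP]
    simp [Fin.sum_univ_two, Multiset.singleton_add]

theorem IsBalanced.exists_pairing [Fintype ι] [DecidableEq ι] {F : ι → Multiset 𝕜}
    (hF : IsBalanced F) {m : ℕ} (hcard : ∑ i, (F i).card = 2 * m) :
    ∃ P : Fin m → Fin 2 → ι × 𝕜, (∀ i j, (P i j).2 ∈ F (P i j).1) ∧
      (∀ i, (P i 0).2 + (P i 1).2 = 0) ∧
      ∀ k (f : 𝕜 → 𝕜),
        (∑ i, ∑ j, if (P i j).1 = k then f (P i j).2 else 0) = ((F k).map f).sum := by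
  have hsnd : (∑ i, (F i).map (Prod.mk i)).map Prod.snd = ∑ i, F i := by
    simp [multiset_map_finset_sum, Multiset.map_map]
  obtain ⟨P, hP, hP0⟩ := exists_pairing_of_map_neg_eq (M := ∑ i, (F i).map (Prod.mk i)) Prod.snd
    (by simpa using hcard) (by rw [hsnd]; exact hF)
  refine ⟨P, fun i j => ?_, hP0, fun k f => ?_⟩
  · have hmem : P i j ∈ ∑ i, (F i).map (Prod.mk i) := by
      rw [← hP]
      simp only [Multiset.mem_sum, Multiset.mem_singleton]
      exact ⟨i, Finset.mem_univ i, j, Finset.mem_univ j, rfl⟩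
    obtain ⟨k, -, hk⟩ := Multiset.mem_sum.1 hmem
    obtain ⟨d, hd, hdP⟩ := Multiset.mem_map.1 hk
    rwa [← hdP]
  · have h := congrArg (fun M => (M.map fun u : ι × 𝕜 => if u.1 = k then f u.2 else 0).sum) hP
    simp only [multiset_map_finset_sum, Multiset.sum_sum, Multiset.map_singleton,
      Multiset.sum_singleton, Multiset.map_map, Function.comp_def] at h
    rw [h, Finset.sum_eq_single k (fun i _ hik => by simp [hik]) (by simp)]
    simp

end Pairing

namespace MuffinSolution

variable {m s : ℕ} (D : MuffinSolution m s)

theorem smallest_le (i : Fin m) (j : Fin 2) : D.smallest ≤ D.size i j :=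
  ciInf_le (Set.finite_range fun p : Fin m × Fin 2 => D.size p.1 p.2).bddBelow (i, j)

theorem exists_size_eq_smallest (hm : 0 < m) : ∃ i j, D.size i j = D.smallest := by
  have : Nonempty (Fin m × Fin 2) := ⟨(⟨0, hm⟩, 0)⟩
  obtain ⟨⟨i, j⟩, h⟩ := exists_eq_ciInf_of_finite (f := fun p : Fin m × Fin 2 => D.size p.1 p.2)
  exact ⟨i, j, h⟩

theorem numPieces_mul_eq_sum (k : Fin s) (c : ℝ) :
    (D.numPieces k : ℝ) * c = ∑ i, ∑ j, if D.student i j = k then c else 0 := by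
  unfold numPieces
  rw [← Fintype.sum_prod_type' (f := fun i j => if D.student i j = k then c else 0),
    ← Finset.sum_filter, Finset.sum_const, nsmul_eq_mul]

end MuffinSolution

namespace IsBalanced

variable {m s : ℕ}

theorem exists_muffinSolution {F : Fin s → Multiset ℝ} (hF : IsBalanced F) (hs : 0 < s)
    (hsum : ∀ k, (F k).sum = (m : ℝ) / s - (F k).card / 2) (hlt : ∀ k, ∀ d ∈ F k, |d| < 1 / 2) :
    ∃ D : MuffinSolution m s, (∀ k, D.numPieces k = (F k).card) ∧
      ∀ i j, D.size i j - 1 / 2 ∈ F (D.student i j) := by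
  have hs' : (s : ℝ) ≠ 0 := by positivity
  have hcard : ∑ k, (F k).card = 2 * m := by
    have h := hF.sum_eq_zero
    simp only [hsum, Finset.sum_sub_distrib, Finset.sum_const, Finset.card_univ, Fintype.card_fin,
      nsmul_eq_mul, mul_div_cancel₀ (m : ℝ) hs', ← Finset.sum_div] at h
    have h' : ∑ k, ((F k).card : ℝ) = 2 * m := by linarith
    exact_mod_cast h'
  obtain ⟨P, hmem, hpair, hstudent⟩ := hF.exists_pairing hcard
  have htotal (k : Fin s) : ((F k).map fun d => 1 / 2 + d).sum = (m : ℝ) / s := by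
    rw [Multiset.sum_map_add, Multiset.map_const', Multiset.sum_replicate, Multiset.map_id', hsum,
      nsmul_eq_mul]
    ring
  let D : MuffinSolution m s :=
    { size := fun i j => 1 / 2 + (P i j).2
      student := fun i j => (P i j).1
      size_pos := fun i j => by linarith [(abs_lt.1 (hlt _ _ (hmem i j))).1]
      sum_muffin := fun i => by rw [Fin.sum_univ_two]; linarith [hpair i]
      sum_student := fun k => by rw [← htotal k, ← hstudent k fun d => 1 / 2 + d] }
  refine ⟨D, fun k => ?_, fun i j => by simpa [D] using hmem i j⟩
  have h := D.numPieces_mul_eq_sum k 1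
  rw [hstudent k fun _ => 1] at h
  simpa using h

theorem exists_muffinSolution_of_partial {ι : Type*} [Fintype ι] {G : ι → Multiset ℝ}
    (hG : IsBalanced G) {deg : ι → ℕ} {L C r : ℝ} (hm : 0 < m) (hs : 0 < s)
    (hι : Fintype.card ι = s) (hdeg : ∑ i, deg i = 2 * m) (hC : 0 < C) (hC' : C ≤ 1 / 2)
    (hr : r < 1 / 2) (hGr : ∀ i, ∀ d ∈ G i, |d| ≤ r)
    (h : ∀ i, ((G i).card = deg i ∧ (G i).sum = (m : ℝ) / s - deg i / 2) ∨
      ((G i).card + 2 ≤ deg i ∧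
        (m : ℝ) / s - deg i / 2 - (G i).sum ∈ Set.Icc L (L + 2 * C))) :
    ∃ D : MuffinSolution m s, (∃ e : Fin s ≃ ι, ∀ k, D.numPieces k = deg (e k)) ∧
      (1 / 2 - r ≤ D.smallest ∨ 1 / 2 - C < D.smallest) := by
  have hneed : ∑ i, ((m : ℝ) / s - deg i / 2) = 0 := by
    have hdeg' : ∑ i, (deg i : ℝ) = 2 * m := by exact_mod_cast hdeg
    rw [Finset.sum_sub_distrib, Finset.sum_const, Finset.card_univ, hι, nsmul_eq_mul,
      ← Finset.sum_div, hdeg']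
    field_simp
    ring
  obtain ⟨H, hH, hprop⟩ := hG.exists_completion hC hneed h
  let e : Fin s ≃ ι := (Fintype.equivFinOfCardEq hι).symm
  have hdev : ∀ i, ∀ d ∈ H i, |d| ≤ r ∨ |d| < C := fun i d hd =>
    ((hprop i).2.2 d hd).imp_left (hGr i d)
  obtain ⟨D, hnum, hsize⟩ := (hH.comp_equiv e).exists_muffinSolution (m := m) hs
    (fun k => by simp [hprop])
    (fun k d hd => (hdev _ d hd).elim hr.trans_le' fun h => h.trans_le hC')
  refine ⟨D, ⟨e, fun k => (hnum k).trans (hprop _).1⟩, ?_⟩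
  obtain ⟨i, j, hij⟩ := D.exists_size_eq_smallest hm
  rw [← hij]
  refine (hdev _ _ (hsize i j)).imp (fun h => ?_) fun h => ?_
  · linarith [(abs_le.1 h).1]
  · linarith [(abs_lt.1 h).1]

end IsBalanced

theorem sum_replicate {γ 𝕜 : Type*} [Fintype γ] (c : γ → ℕ) (w : 𝕜) :
    ∑ i, Multiset.replicate (c i) w = .replicate (∑ i, c i) w :=
  (map_sum (Multiset.replicateAddMonoidHom w) c _).symm

theorem isBalanced_elim_replicate {α β 𝕜 : Type*} [Fintype α] [Fintype β] [AddCommGroup 𝕜]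
    {a : α → ℕ} {b : β → ℕ} (hab : ∑ i, a i = ∑ j, b j) (v : 𝕜) :
    IsBalanced (Sum.elim (fun i => .replicate (a i) v) fun j => .replicate (b j) (-v)) := by
  simp only [IsBalanced, Fintype.sum_sum_type, Sum.elim_inl, Sum.elim_inr,
    sum_replicate, hab, Multiset.map_add, Multiset.map_replicate, neg_neg]
  exact add_comm _ _

theorem forall_mem_elim_replicate_abs_le {α β 𝕜 : Type*} [AddCommGroup 𝕜] [LinearOrder 𝕜]
    [IsOrderedAddMonoid 𝕜] {a : α → ℕ} {b : β → ℕ} {v : 𝕜} (hv : 0 ≤ v) (i : α ⊕ β) :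
    ∀ d ∈ Sum.elim (fun i => Multiset.replicate (a i) v) (fun j => .replicate (b j) (-v)) i,
      |d| ≤ v := by
  intro d hd
  rcases i with i | j
  · rw [Multiset.eq_of_mem_replicate hd, abs_of_nonneg hv]
  · rw [Multiset.eq_of_mem_replicate hd, abs_neg, abs_of_nonneg hv]

theorem exists_muffinSolution_of_replicate {α β : Type*} [Fintype α] [Fintype β] {m s : ℕ}
    {a degA : α → ℕ} {b degB : β → ℕ} {v L C : ℝ} (hm : 0 < m) (hs : 0 < s)
    (hcard : Fintype.card α + Fintype.card β = s) (hdeg : ∑ i, degA i + ∑ j, degB j = 2 * m)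
    (hv : 0 ≤ v) (hv' : v < 1 / 2) (hC : 0 < C) (hC' : C ≤ 1 / 2) (hab : ∑ i, a i = ∑ j, b j)
    (ha : ∀ i, (a i = degA i ∧ a i * v = (m : ℝ) / s - degA i / 2) ∨
      (a i + 2 ≤ degA i ∧ (m : ℝ) / s - degA i / 2 - a i * v ∈ Set.Icc L (L + 2 * C)))
    (hb : ∀ j, (b j = degB j ∧ -(b j * v) = (m : ℝ) / s - degB j / 2) ∨
      (b j + 2 ≤ degB j ∧ (m : ℝ) / s - degB j / 2 + b j * v ∈ Set.Icc L (L + 2 * C))) :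
    ∃ D : MuffinSolution m s,
      (∃ e : Fin s ≃ α ⊕ β, ∀ k, D.numPieces k = Sum.elim degA degB (e k)) ∧
      (1 / 2 - v ≤ D.smallest ∨ 1 / 2 - C < D.smallest) := by
  refine (isBalanced_elim_replicate hab v).exists_muffinSolution_of_partial (L := L) hm hs
    (by simpa using hcard) (by simpa using hdeg) hC hC' hv' ?_ ?_
  · exact forall_mem_elim_replicate_abs_le hv
  · rintro (i | j)
    · simpa using ha i
    · simpa using hb j

theorem exists_add_one_mul_eq_half (n : ℕ) : ∃ u : ℝ, (n + 1) * u = 1 / 2 :=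
  ⟨1 / 2 / (n + 1), mul_div_cancel₀ _ n.cast_add_one_ne_zero⟩

theorem pos_of_add_one_mul_eq_half {n : ℕ} {u : ℝ} (hu : (n + 1) * u = 1 / 2) : 0 < u :=
  pos_of_mul_pos_right (by rw [hu]; exact half_pos one_pos) n.cast_add_one_pos.le

/-- The distribution of pieces in the fully-constrained problem `(m, s)`: of the `s` students, `p`
receive `n` pieces and `q` receive `n + 1` pieces. Positivity of `p` makes `n` the integer part of
`2 * m / s`. -/
structure PieceSplit (m s n p q : ℕ) : Prop where
  pos : 0 < p
  students : p + q = s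
  pieces : n * p + (n + 1) * q = 2 * m

namespace PieceSplit

variable {m s n p q : ℕ} (h : PieceSplit m s n p q)
include h

theorem students_pos : 0 < s :=
  h.students ▸ Nat.add_pos_left h.pos q

theorem muffins_pos (hn : 0 < n) : 0 < m := by
  have := h.pieces
  have := Nat.mul_pos hn h.pos
  omega

theorem cast_students_pos : (0 : ℝ) < p + q := by
  exact_mod_cast h.students ▸ h.students_pos

theorem div_sub_mul : ((m : ℝ) / s - n / 2) * (2 * (p + q)) = q := by
  have hs := h.cast_students_pos.ne'
  have hpieces : (n : ℝ) * p + (n + 1) * q = 2 * m := by exact_mod_cast h.pieces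
  rw [← h.students, Nat.cast_add]
  field_simp
  linear_combination -hpieces

theorem div_sub_sub_mul {u : ℝ} (hu : (n + 1) * u = 1 / 2) (a : ℝ) :
    ((m : ℝ) / s - n / 2 - a * u) * (p + q) = u * ((n + 1 - a) * q - a * p) := by
  linear_combination h.div_sub_mul / 2 - q * hu

theorem mul_le_div_sub_iff {u : ℝ} (hu : (n + 1) * u = 1 / 2) (a : ℝ) :
    a * u ≤ (m : ℝ) / s - n / 2 ↔ a * p ≤ (n + 1 - a) * q := by
  rw [← sub_nonneg, ← mul_nonneg_iff_of_pos_right h.cast_students_pos, h.div_sub_sub_mul hu,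
    mul_nonneg_iff_of_pos_left (pos_of_add_one_mul_eq_half hu), sub_nonneg]

theorem div_sub_le_mul_iff {u : ℝ} (hu : (n + 1) * u = 1 / 2) (a : ℝ) :
    (m : ℝ) / s - n / 2 ≤ a * u ↔ (n + 1 - a) * q ≤ a * p := by
  have hmul : (a * u - ((m : ℝ) / s - n / 2)) * (p + q) = u * (a * p - (n + 1 - a) * q) := by
    linear_combination -h.div_sub_sub_mul hu a
  rw [← sub_nonneg, ← mul_nonneg_iff_of_pos_right h.cast_students_pos, hmul,
    mul_nonneg_iff_of_pos_left (pos_of_add_one_mul_eq_half hu), sub_nonneg]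

theorem half_le_div : (n : ℝ) / 2 ≤ (m : ℝ) / s := by
  refine sub_nonneg.1 (nonneg_of_mul_nonneg_left ?_ (mul_pos two_pos h.cast_students_pos))
  rw [h.div_sub_mul]
  exact q.cast_nonneg

theorem half_lt_div (hq : 0 < q) : (n : ℝ) / 2 < (m : ℝ) / s := by
  refine sub_pos.1 (pos_of_mul_pos_left ?_ (mul_pos two_pos h.cast_students_pos).le)
  rw [h.div_sub_mul]
  exact_mod_cast hq

theorem div_lt_half : (m : ℝ) / s < (n + 1) / 2 := by
  have hp : (0 : ℝ) < p := by exact_mod_cast h.pos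
  have h1 : ((m : ℝ) / s - (n + 1) / 2) * (2 * (p + q)) = -p := by
    linear_combination h.div_sub_mul
  refine sub_neg.1 (neg_of_mul_neg_left ?_ (mul_pos two_pos h.cast_students_pos).le)
  rw [h1]
  exact neg_neg_of_pos hp

theorem floor_eq : ⌊2 * ((m : ℝ) / s)⌋₊ = n := by
  have h1 := h.half_le_div
  have h2 := h.div_lt_half
  exact (Nat.floor_eq_iff (by linarith [n.cast_nonneg (α := ℝ)])).2 ⟨by linarith, by linarith⟩

theorem threshold_le_iff :
    (n : ℝ) * (n + 2) / (2 * (n + 1)) ≤ (m : ℝ) / s ↔ n * p ≤ q := by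
  obtain ⟨u, hu⟩ := exists_add_one_mul_eq_half n
  have heq : (n : ℝ) * (n + 2) / (2 * (n + 1)) = n / 2 + n * u := by
    rw [div_eq_iff (by positivity)]
    linear_combination -2 * n * hu
  rw [heq, ← le_sub_iff_add_le', h.mul_le_div_sub_iff hu, add_sub_cancel_left, one_mul]
  exact_mod_cast Iff.rfl

theorem div_lt_threshold (hlt : q < n * p) :
    (m : ℝ) / s < (n : ℝ) * (n + 2) / (2 * (n + 1)) :=
  not_le.1 (h.threshold_le_iff.not.2 hlt.not_ge)

end PieceSplit

theorem div_two_mul_add_one_eq {n : ℕ} {u : ℝ} (hu : (n + 1) * u = 1 / 2) :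
    (n : ℝ) / (2 * (n + 1)) = 1 / 2 - u := by
  rw [div_eq_iff (by positivity)]
  linear_combination 2 * hu

theorem lt_half_of_add_one_mul_eq_half {n : ℕ} {u : ℝ} (hn : 0 < n)
    (hu : (n + 1) * u = 1 / 2) : u < 1 / 2 := by
  have hn' : (0 : ℝ) < n := by exact_mod_cast hn
  linarith [mul_pos hn' (pos_of_add_one_mul_eq_half hu)]

theorem exists_levels {p q n : ℕ} (hpq : q ≤ (n - 2) * p) (hn : 2 ≤ n) :
    ∃ l r, l + r + 2 = n ∧ p * l ≤ q * (r + 3) ∧ p * l ≤ q * (l + r + 1) ∧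
      q * (r + 1) ≤ p * (l + 2) ∧ q * (r + 1) ≤ p * (l + r) := by
  obtain ⟨N, rfl⟩ := Nat.exists_eq_add_of_le' hn
  simp only [Nat.add_sub_cancel] at hpq
  set P : ℕ → Prop := fun l => p * l ≤ q * (N + 3 - l) ∧ p * l ≤ q * (N + 1) with hP
  have hP0 : P 0 := by simp [hP]
  set l := Nat.findGreatest P N with hl
  have hlP : P l := Nat.findGreatest_spec (P := P) (Nat.zero_le N) hP0
  obtain ⟨r, hr⟩ := Nat.exists_eq_add_of_le (Nat.findGreatest_le (P := P) N)
  rw [← hl] at hr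
  have h3 : N + 3 - l = r + 3 := by omega
  refine ⟨l, r, by omega, h3 ▸ hlP.1, hr ▸ hlP.2, ?_⟩
  rcases Nat.eq_zero_or_pos r with rfl | hr0
  · rw [hr, add_zero, mul_comm] at hpq
    constructor <;> linarith
  · have hnot : ¬ P (l + 1) := Nat.findGreatest_is_greatest (P := P) (lt_add_one _) (by omega)
    have hlarge : q * (r + 1) ≤ p * (l + 1) := by
      by_contra! hlt
      refine hnot ⟨hlt.le.trans ?_, hlt.le.trans ?_⟩ <;> gcongr <;> omega
    constructor <;> refine hlarge.trans ?_ <;> gcongr <;> omega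

theorem exists_sum_eq_sum_of_mul_le_mul {p q k l k' l' : ℕ} (hkl : k ≤ l) (hkl' : k' ≤ l')
    (h : p * k ≤ q * l') (h' : q * k' ≤ p * l) :
    ∃ (a : Fin p → ℕ) (b : Fin q → ℕ), ∑ i, a i = ∑ j, b j ∧
      (∀ i, k ≤ a i ∧ a i ≤ l) ∧ ∀ j, k' ≤ b j ∧ b j ≤ l' := by
  obtain ⟨a, hsum_a, ha⟩ := exists_sum_eq_of_mul_le_of_le_mul (q := p)
    (le_max_left (p * k) (q * k')) (max_le (Nat.mul_le_mul_left p hkl) h')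
  obtain ⟨b, hsum_b, hb⟩ := exists_sum_eq_of_mul_le_of_le_mul (q := q)
    (le_max_right (p * k) (q * k')) (max_le h (Nat.mul_le_mul_left q hkl'))
  exact ⟨a, b, hsum_a.trans hsum_b.symm, ha, hb⟩

namespace PieceSplit

variable {m s n p q : ℕ} (h : PieceSplit m s n p q)
include h

theorem fullyFeasible_iff (D : MuffinSolution m s) :
    D.FullyFeasible ↔ ∀ k, D.numPieces k = n ∨ D.numPieces k = n + 1 := by
  rw [MuffinSolution.FullyFeasible, h.floor_eq]

theorem exists_fullyFeasible_of_isBalanced {α β : Type*} [Fintype α] [Fintype β]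
    {G : α ⊕ β → Multiset ℝ} (hG : IsBalanced G) (hn : 0 < n) {L C r : ℝ}
    (hα : Fintype.card α = p) (hβ : Fintype.card β = q) (hC : 0 < C) (hC' : C ≤ 1 / 2)
    (hr : r < 1 / 2) (hGr : ∀ i, ∀ d ∈ G i, |d| ≤ r)
    (hGα : ∀ i, ((G (.inl i)).card = n ∧ (G (.inl i)).sum = (m : ℝ) / s - n / 2) ∨
      ((G (.inl i)).card + 2 ≤ n ∧
        (m : ℝ) / s - n / 2 - (G (.inl i)).sum ∈ Set.Icc L (L + 2 * C)))
    (hGβ : ∀ j, (G (.inr j)).card + 1 ≤ n ∧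
      (m : ℝ) / s - (n + 1) / 2 - (G (.inr j)).sum ∈ Set.Icc L (L + 2 * C)) :
    ∃ D : MuffinSolution m s, D.FullyFeasible ∧
      (1 / 2 - r ≤ D.smallest ∨ 1 / 2 - C < D.smallest) := by
  obtain ⟨D, ⟨e, he⟩, hD⟩ := hG.exists_muffinSolution_of_partial (L := L)
    (deg := Sum.elim (fun _ => n) fun _ => n + 1) (h.muffins_pos hn) h.students_pos
    (by rw [Fintype.card_sum, hα, hβ, h.students])
    (by simpa [hα, hβ, mul_comm] using h.pieces) hC hC' hr hGr (by
      rintro (i | j)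
      · exact hGα i
      · exact .inr ⟨Nat.succ_le_succ (hGβ j).1, by simpa using (hGβ j).2⟩)
  refine ⟨D, (h.fullyFeasible_iff D).2 fun k => ?_, hD⟩
  rw [he k]
  rcases e k with i | j
  · exact .inl rfl
  · exact .inr rfl

theorem exists_fullyFeasible_of_counts (hn : 0 < n) {a : Fin p → ℕ} {b : Fin q → ℕ} {v L C : ℝ}
    (hv : 0 ≤ v) (hv' : v < 1 / 2) (hC : 0 < C) (hC' : C ≤ 1 / 2) (hab : ∑ i, a i = ∑ j, b j)
    (ha : ∀ i, (a i = n ∧ n * v = (m : ℝ) / s - n / 2) ∨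
      (a i + 2 ≤ n ∧ (m : ℝ) / s - n / 2 - a i * v ∈ Set.Icc L (L + 2 * C)))
    (hb : ∀ j, b j + 1 ≤ n ∧ (m : ℝ) / s - (n + 1) / 2 + b j * v ∈ Set.Icc L (L + 2 * C)) :
    ∃ D : MuffinSolution m s, D.FullyFeasible ∧
      (1 / 2 - v ≤ D.smallest ∨ 1 / 2 - C < D.smallest) := by
  refine h.exists_fullyFeasible_of_isBalanced (L := L) (isBalanced_elim_replicate hab v) hn
    (Fintype.card_fin p) (Fintype.card_fin q) hC hC' hv' ?_ (fun i => ?_) fun j => ?_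
  · exact forall_mem_elim_replicate_abs_le hv
  · exact (ha i).imp (fun ⟨hi, hnv⟩ => by simp [hi, hnv]) fun hi => by simpa using hi
  · simpa using hb j

theorem exists_fullyFeasible_of_le_sub_two_mul (hn : 2 ≤ n) (hq : q ≤ (n - 2) * p) :
    ∃ D : MuffinSolution m s, D.FullyFeasible ∧ (n : ℝ) / (2 * (n + 1)) ≤ D.smallest := by
  -- A student with `n` pieces gets between `l` and `l + 2` deviations `u`, one with `n + 1` pieces
  -- between `r + 1` and `r + 3` deviations `-u`. As `(n + 1) * u = 1 / 2` and `l + r + 2 = n`, the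
  -- totals still missing then lie in a common interval of length `2 * u`.
  obtain ⟨l, r, hlr, hl₁, hl₂, hr₁, hr₂⟩ := exists_levels hq hn
  obtain ⟨a, b, hab, ha, hb⟩ := exists_sum_eq_sum_of_mul_le_mul
    (k := l) (l := min (l + 2) (l + r)) (k' := r + 1) (l' := min (r + 3) (l + r + 1))
    (by omega) (by omega) (by rw [← Nat.mul_min_mul_left]; exact le_min hl₁ hl₂)
    (by rw [← Nat.mul_min_mul_left]; exact le_min hr₁ hr₂)
  simp only [le_min_iff] at ha hb
  obtain ⟨u, hu⟩ := exists_add_one_mul_eq_half n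
  have hu0 := pos_of_add_one_mul_eq_half hu
  have hu_lt := lt_half_of_add_one_mul_eq_half (by omega) hu
  have hn' : (n : ℝ) = l + r + 2 := by exact_mod_cast hlr.symm
  set L : ℝ := (m : ℝ) / s - n / 2 - (l + 2) * u with hL
  have hstep_a (i : Fin p) : (m : ℝ) / s - n / 2 - a i * u ∈ Set.Icc L (L + 2 * u) := by
    obtain ⟨h1, h2, -⟩ := ha i
    have h1' : (l : ℝ) * u ≤ a i * u := by gcongr
    have h2' : (a i : ℝ) * u ≤ (l + 2) * u := by gcongr; exact_mod_cast h2
    constructor <;> linarith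
  have hstep_b (j : Fin q) : (m : ℝ) / s - (n + 1) / 2 + b j * u ∈ Set.Icc L (L + 2 * u) := by
    obtain ⟨h1, h2, -⟩ := hb j
    have h1' : (r + 1 : ℝ) * u ≤ b j * u := by gcongr; exact_mod_cast h1
    have h2' : (b j : ℝ) * u ≤ (r + 3) * u := by gcongr; exact_mod_cast h2
    have hu' : (l + r + 2 + 1) * u = 1 / 2 := by rw [← hu, hn']
    constructor <;> linarith
  obtain ⟨D, hD, hsmall⟩ := h.exists_fullyFeasible_of_counts (by omega) hu0.le hu_lt hu0 hu_lt.le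
    hab (fun i => .inr ⟨by have := ha i; omega, hstep_a i⟩)
    (fun j => ⟨by have := hb j; omega, hstep_b j⟩)
  refine ⟨D, hD, ?_⟩
  rw [div_two_mul_add_one_eq hu]
  rcases hsmall with hsmall | hsmall <;> linarith

theorem exists_fullyFeasible_of_mul_le_mul {l : ℕ} (hl : l ≤ 2) (hln : l + 1 ≤ n) (hn : 2 ≤ n)
    (hpq : n * p ≤ q * l) :
    ∃ D : MuffinSolution m s, D.FullyFeasible ∧ 1 - (m : ℝ) / s / n ≤ D.smallest := by
  have hq : 0 < q := Nat.pos_of_mul_pos_right ((Nat.mul_pos (by omega) h.pos).trans_le hpq)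
  have hn' : (2 : ℝ) ≤ n := by exact_mod_cast hn
  have hx := h.half_lt_div hq
  have hx' := h.div_lt_half
  set v : ℝ := (m : ℝ) / s / n - 1 / 2 with hv
  have hnv : n * v = (m : ℝ) / s - n / 2 := by rw [hv]; field_simp
  have hv0 : 0 < v := pos_of_mul_pos_right (by linarith : 0 < n * v) (by positivity)
  have hv1 : v < 1 / 2 := by nlinarith
  obtain ⟨b, hsum, hb⟩ := exists_sum_eq_of_mul_le_of_le_mul (k := 0) (by simp) hpq
  obtain ⟨D, hD, hsmall⟩ := h.exists_fullyFeasible_of_counts (by omega) hv0.le hv1 hv0 hv1.le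
    (a := fun _ => n) (by rw [hsum]; simp [mul_comm]) (L := (m : ℝ) / s - (n + 1) / 2)
    (fun _ => .inl ⟨rfl, hnv⟩) (fun j => by
      have hb' : (b j : ℝ) * v ≤ 2 * v := by gcongr; exact_mod_cast (hb j).2.trans hl
      exact ⟨by linarith [(hb j).2], le_add_of_nonneg_right (by positivity), by linarith⟩)
  refine ⟨D, hD, ?_⟩
  rcases hsmall with hsmall | hsmall <;> linarith

end PieceSplit

/-- Prescribed deviations for `c + w` students with `N + 2` pieces and `c + N * (c + w)` students
with `N + 3` pieces. All pieces of the first `c` students are prescribed: `N + 1` of them deviate by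
`u`, and `ε` is whatever then makes the total right. -/
def correctedDeviations {𝕜 : Type*} [AddCommGroup 𝕜] (c w N : ℕ) (u ε : 𝕜) :
    (Fin c ⊕ Fin w) ⊕ (Fin c ⊕ Fin (N * (c + w))) → Multiset 𝕜 :=
  Sum.elim (Sum.elim (fun _ => .replicate (N + 1) u + {ε}) fun _ => .replicate N u)
    (Sum.elim (fun _ => {-u} + {-ε}) fun _ => {-u})

theorem isBalanced_correctedDeviations {𝕜 : Type*} [AddCommGroup 𝕜] (c w N : ℕ) (u ε : 𝕜) :
    IsBalanced (correctedDeviations c w N u ε) := by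
  have hcount : c * (N + 1) + w * N = c + N * (c + w) := by ring
  have hu := isBalanced_elim_replicate
    (a := Sum.elim (fun _ : Fin c => N + 1) fun _ : Fin w => N)
    (b := fun _ : Fin c ⊕ Fin (N * (c + w)) => 1) (by simpa using hcount) u
  have hε := isBalanced_elim_replicate
    (a := Sum.elim (fun _ : Fin c => 1) fun _ : Fin w => 0)
    (b := Sum.elim (fun _ : Fin c => 1) fun _ : Fin (N * (c + w)) => 0) (by simp) ε
  convert hu.add hε using 1
  ext1 i
  rcases i with (_ | _) | (_ | _) <;> simp [correctedDeviations]

theorem abs_le_of_mem_correctedDeviations {𝕜 : Type*} [AddCommGroup 𝕜] [LinearOrder 𝕜]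
    [IsOrderedAddMonoid 𝕜] (c w N : ℕ) {u ε : 𝕜} (hu : 0 ≤ u) (hε : |ε| ≤ u) :
    ∀ i, ∀ d ∈ correctedDeviations c w N u ε i, |d| ≤ u := by
  simp only [correctedDeviations, Sum.forall, Sum.elim_inl, Sum.elim_inr, Multiset.mem_add,
    Multiset.mem_replicate, Multiset.mem_singleton]
  refine ⟨⟨?_, ?_⟩, ?_, ?_⟩ <;> intro _ d hd
  · rcases hd with ⟨-, rfl⟩ | rfl
    exacts [(abs_of_nonneg hu).le, hε]
  · rw [hd.2, abs_of_nonneg hu]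
  · rcases hd with rfl | rfl <;> rw [abs_neg]
    exacts [(abs_of_nonneg hu).le, hε]
  · rw [hd, abs_neg, abs_of_nonneg hu]

theorem PieceSplit.exists_fullyFeasible_of_mul_le_of_le_mul {m s N c w : ℕ}
    (h : PieceSplit m s (N + 2) (c + w) (N * (c + w) + c)) (hN : 1 ≤ N) {u : ℝ}
    (hu : (N + 3) * u = 1 / 2) (hle : (N + 1) * u ≤ (m : ℝ) / s - (N + 2) / 2)
    (hle' : (m : ℝ) / s - (N + 2) / 2 ≤ (N + 2) * u) :
    ∃ D : MuffinSolution m s, D.FullyFeasible ∧ 1 / 2 - u ≤ D.smallest := by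
  have hu' : ((N + 2 : ℕ) + 1) * u = 1 / 2 := by rw [← hu]; push_cast; ring
  have hu0 := pos_of_add_one_mul_eq_half hu'
  have hu1 := lt_half_of_add_one_mul_eq_half (by omega) hu'
  obtain ⟨ε, hε⟩ : ∃ ε, ε = (m : ℝ) / s - (N + 2) / 2 - (N + 1) * u := ⟨_, rfl⟩
  have hε0 : |ε| ≤ u := abs_le.2 ⟨by linarith, by linarith⟩
  obtain ⟨D, hD, hsmall⟩ := h.exists_fullyFeasible_of_isBalanced
    (isBalanced_correctedDeviations c w N u ε) (by omega) (L := (m : ℝ) / s - (N + 3) / 2 + u)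
    (by simp) (by simp [add_comm]) hu0 hu1.le hu1
    (abs_le_of_mem_correctedDeviations c w N hu0.le hε0)
    (by
      simp only [correctedDeviations, Sum.forall, Sum.elim_inl, Sum.elim_inr, Multiset.card_add,
        Multiset.card_replicate, Multiset.card_singleton, Multiset.sum_add, Multiset.sum_replicate,
        Multiset.sum_singleton, nsmul_eq_mul]
      push_cast
      exact ⟨fun _ => .inl ⟨trivial, by linarith⟩,
        fun _ => .inr ⟨le_rfl, by linarith, by linarith⟩⟩)
    (by
      simp only [correctedDeviations, Sum.forall, Sum.elim_inl, Sum.elim_inr, Multiset.card_add,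
        Multiset.card_singleton, Multiset.sum_add, Multiset.sum_singleton]
      push_cast
      exact ⟨fun _ => ⟨by omega, by linarith, by linarith⟩,
        fun _ => ⟨trivial, by linarith, by linarith⟩⟩)
  exact ⟨D, hD, hsmall.elim id le_of_lt⟩

namespace PieceSplit

variable {m s n p q : ℕ} (h : PieceSplit m s n p q)
include h

theorem exists_fullyFeasible_of_sub_two_mul_le (hn : 3 ≤ n) (hq : (n - 2) * p ≤ q)
    (hq' : q ≤ (n - 1) * p) :
    ∃ D : MuffinSolution m s, D.FullyFeasible ∧ (n : ℝ) / (2 * (n + 1)) ≤ D.smallest := by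
  obtain ⟨N, rfl⟩ : ∃ N, n = N + 2 := Nat.exists_eq_add_of_le' (by omega)
  simp only [Nat.add_sub_cancel, show N + 2 - 1 = N + 1 by omega] at hq hq'
  obtain ⟨c, rfl⟩ := Nat.exists_eq_add_of_le hq
  obtain ⟨w, rfl⟩ : ∃ w, p = c + w := Nat.exists_eq_add_of_le (by linarith)
  obtain ⟨u, hu⟩ := exists_add_one_mul_eq_half (N + 2)
  have hN : (1 : ℝ) ≤ N := by exact_mod_cast (by omega : 1 ≤ N)
  have hle := (h.mul_le_div_sub_iff hu (N + 1)).2 (by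
    push_cast
    nlinarith [mul_le_mul_of_nonneg_right hN (by positivity : (0 : ℝ) ≤ c + w)])
  have hle' := (h.div_sub_le_mul_iff hu (N + 2)).2 (by push_cast; nlinarith)
  rw [div_two_mul_add_one_eq hu]
  push_cast at hu hle hle'
  exact h.exists_fullyFeasible_of_mul_le_of_le_mul (by omega) (by linarith) hle hle'

theorem not_fullyFeasible_of_numPieces_eq {D : MuffinSolution m s} {k : Fin s}
    (hk : D.numPieces k = n + 2) : ¬ D.FullyFeasible := fun hD => by
  have := (h.fullyFeasible_iff D).1 hD k
  omega

theorem lt_half_of_mul_eq {w : ℝ} (hn : 2 ≤ n) (hw : 0 < w)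
    (hnw : n * w = (m : ℝ) / s - n / 2) : w < 1 / 2 := by
  have hn' : 2 * w ≤ n * w := by gcongr; exact_mod_cast hn
  linarith [h.div_lt_half]

end PieceSplit

theorem PieceSplit.exists_fullyFeasible_div_four_lt {m s p q : ℕ} (h : PieceSplit m s 2 p q)
    (hpq : q < 2 * p) :
    ∃ D : MuffinSolution m s, D.FullyFeasible ∧ (m : ℝ) / s / 4 < D.smallest := by
  obtain ⟨k, rfl⟩ : ∃ k, q = 2 * k := ⟨m - p - q, by have := h.pieces; omega⟩
  obtain ⟨a, hsum, ha⟩ := exists_sum_eq_of_mul_le_of_le_mul (q := p) (N := k) (k := 0) (l := 1)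
    (Nat.zero_le k) (by linarith)
  have hx : (m : ℝ) / s < 4 / 3 := (h.div_lt_threshold hpq).trans_eq (by norm_num)
  have hx1 : 1 ≤ (m : ℝ) / s := by simpa using h.half_le_div
  -- The choice of `C` makes every piece that is not prescribed larger than `m / s / 4`.
  obtain ⟨D, hD, hsmall⟩ := h.exists_fullyFeasible_of_counts two_pos
    (a := fun i => 2 * a i) (b := fun _ => 1) (v := (m : ℝ) / s / 2 - 1 / 2)
    (L := 3 * ((m : ℝ) / s) / 2 - 2) (C := 1 / 2 - (m : ℝ) / s / 4) (by linarith) (by linarith)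
    (by linarith) (by linarith) (by rw [← Finset.mul_sum, hsum]; simp)
    (fun i => by
      obtain hi | hi : a i = 0 ∨ a i = 1 := by have := (ha i).2; omega
      · simp only [hi]
        push_cast
        exact .inr ⟨trivial, by linarith, by linarith⟩
      · simp only [hi]
        push_cast
        exact .inl ⟨trivial, by linarith⟩)
    (fun _ => by
      push_cast
      exact ⟨trivial, by linarith, by linarith⟩)
  exact ⟨D, hD, by rcases hsmall with hsmall | hsmall <;> linarith⟩

theorem PieceSplit.exists_not_fullyFeasible_of_counts {m s n p q : ℕ}
    (h : PieceSplit m s n p (q + 2)) (hn : 2 ≤ n) {L w : ℝ} {b₀ : ℕ} {b : Fin q → ℕ} (hw : 0 < w)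
    (hnw : n * w = (m : ℝ) / s - n / 2) (hsum : n * (p + 1) = b₀ + ∑ j, b j)
    (hb₀ : (b₀ = n + 2 ∧ -((n + 2) * w) = (m : ℝ) / s - (n + 2) / 2) ∨
      (b₀ ≤ n ∧ (m : ℝ) / s - (n + 2) / 2 + b₀ * w ∈ Set.Icc L (L + 2 * w)))
    (hb : ∀ j, b j ≤ 1 ∧ (m : ℝ) / s - (n + 1) / 2 + b j * w ∈ Set.Icc L (L + 2 * w)) :
    ∃ D : MuffinSolution m s, ¬ D.FullyFeasible ∧ 1 / 2 - w ≤ D.smallest := by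
  have hw' := h.lt_half_of_mul_eq hn hw hnw
  have hcard : Fintype.card (Fin (p + 1)) + Fintype.card (Unit ⊕ Fin q) = s := by
    rw [← h.students, Fintype.card_sum, Fintype.card_fin, Fintype.card_fin, Fintype.card_unit]
    omega
  have hdeg : ∑ _i : Fin (p + 1), n + ∑ j : Unit ⊕ Fin q, Sum.elim (fun _ => n + 2)
      (fun _ => n + 1) j = 2 * m := by
    rw [← h.pieces]
    simp only [Fintype.sum_sum_type, Sum.elim_inl, Sum.elim_inr, Finset.sum_const,
      Finset.card_univ, Fintype.card_fin, Fintype.card_unit, smul_eq_mul]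
    ring
  have hab : ∑ _i : Fin (p + 1), n = ∑ j, Sum.elim (fun _ : Unit => b₀) b j := by
    simpa [mul_comm] using hsum
  obtain ⟨D, ⟨e, he⟩, hsmall⟩ := exists_muffinSolution_of_replicate (L := L)
    (h.muffins_pos (by omega)) h.students_pos hcard hdeg hw.le hw' hw hw'.le hab
    (fun _ => .inl ⟨rfl, hnw⟩) (by
      rintro (_ | j) <;> simp only [Sum.elim_inl, Sum.elim_inr] <;> push_cast
      · exact hb₀.imp (fun ⟨h1, h2⟩ => ⟨h1, by rw [h1, ← h2]; push_cast; rfl⟩)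
          fun hb => ⟨by omega, hb.2⟩
      · exact .inr ⟨by linarith [(hb j).1], (hb j).2⟩)
  refine ⟨D, h.not_fullyFeasible_of_numPieces_eq (k := e.symm (.inr (.inl ()))) ?_,
    hsmall.elim id le_of_lt⟩
  rw [he, e.apply_symm_apply]
  rfl

/-- Prescribed deviations for `p + 1` students with `n` pieces, one student with `n + 2` pieces and
`N + 1` students with `n + 1` pieces. All pieces of the first `p + 2` students are prescribed, `ε`
being whatever makes the total of the student with `n + 2` pieces right. -/
def surplusDeviations {𝕜 : Type*} [AddCommGroup 𝕜] (p n N : ℕ) (w ε : 𝕜) :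
    Fin (p + 1) ⊕ (Unit ⊕ (Unit ⊕ Fin N)) → Multiset 𝕜 :=
  Sum.elim (fun _ => .replicate n w)
    (Sum.elim (fun _ => .replicate (n + 1) (-w) + {ε})
      (Sum.elim (fun _ => {-w} + {-ε}) fun _ => {-w}))

theorem isBalanced_surplusDeviations {𝕜 : Type*} [AddCommGroup 𝕜] {p n N : ℕ}
    (hN : n * (p + 1) = n + 2 + N) (w ε : 𝕜) : IsBalanced (surplusDeviations p n N w ε) := by
  have hcount : (p + 1) * n = n + 1 + (1 + N) := by linarith
  have hw := isBalanced_elim_replicate (a := fun _ : Fin (p + 1) => n)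
    (b := Sum.elim (fun _ : Unit => n + 1) fun _ : Unit ⊕ Fin N => 1)
    (by simpa using hcount) w
  have hε : IsBalanced (Sum.elim (fun _ : Fin (p + 1) => 0)
      (Sum.elim (fun _ : Unit => {ε}) (Sum.elim (fun _ : Unit => {-ε}) fun _ : Fin N => 0))) := by
    simpa [IsBalanced] using Multiset.pair_comm (-ε) ε
  convert hw.add hε using 1
  ext1 i
  rcases i with _ | _ | _ | _ <;> simp [surplusDeviations]

theorem abs_le_of_mem_surplusDeviations {𝕜 : Type*} [AddCommGroup 𝕜] [LinearOrder 𝕜]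
    [IsOrderedAddMonoid 𝕜] (p n N : ℕ) {w ε : 𝕜} (hw : 0 ≤ w) (hε : |ε| ≤ w) :
    ∀ i, ∀ d ∈ surplusDeviations p n N w ε i, |d| ≤ w := by
  simp only [surplusDeviations, Sum.forall, Sum.elim_inl, Sum.elim_inr, Multiset.mem_add,
    Multiset.mem_replicate, Multiset.mem_singleton]
  refine ⟨?_, ?_, ?_, ?_⟩ <;> intro _ d hd
  · rw [hd.2, abs_of_nonneg hw]
  · rcases hd with ⟨-, rfl⟩ | rfl
    exacts [(abs_neg w).trans_le (abs_of_nonneg hw).le, hε]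
  · rcases hd with rfl | rfl <;> rw [abs_neg]
    exacts [(abs_of_nonneg hw).le, hε]
  · rw [hd, abs_neg, abs_of_nonneg hw]

namespace PieceSplit

variable {m s n p q : ℕ}

theorem exists_mul_eq_div_sub (h : PieceSplit m s n p q) (hn : 0 < n) (hpq : n * p ≤ q) :
    ∃ w : ℝ, 1 / 2 - w = 1 - (m : ℝ) / s / n ∧ 0 < w ∧ n * w = (m : ℝ) / s - n / 2 ∧
      1 / 2 ≤ (n + 1) * w := by
  obtain ⟨u, hu⟩ := exists_add_one_mul_eq_half n
  have hn' : (0 : ℝ) < n := by exact_mod_cast hn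
  have hw : n * ((m : ℝ) / s / n - 1 / 2) = (m : ℝ) / s - n / 2 := by field_simp
  have huw : u ≤ (m : ℝ) / s / n - 1 / 2 := by
    refine le_of_mul_le_mul_left ?_ hn'
    rw [hw, h.mul_le_div_sub_iff hu, add_sub_cancel_left, one_mul]
    exact_mod_cast hpq
  exact ⟨_, by ring, (pos_of_add_one_mul_eq_half hu).trans_le huw, hw,
    hu.symm.trans_le (mul_le_mul_of_nonneg_left huw n.cast_add_one_pos.le)⟩

theorem exists_not_fullyFeasible_of_eq_mul (h : PieceSplit m s n p (n * p)) (hn : 2 ≤ n) :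
    ∃ D : MuffinSolution m s, ¬ D.FullyFeasible ∧ 1 - (m : ℝ) / s / n ≤ D.smallest := by
  obtain ⟨w, hw_eq, hw, hnw, hle⟩ := h.exists_mul_eq_div_sub (by omega) le_rfl
  have hexact : (n + 1) * w = 1 / 2 := by
    obtain ⟨u, hu⟩ := exists_add_one_mul_eq_half n
    have hle' := (h.div_sub_le_mul_iff hu n).2 (by push_cast; linarith)
    rw [← hnw] at hle'
    have := le_of_mul_le_mul_left hle' (by positivity)
    refine hle.antisymm' ?_
    rw [← hu]
    gcongr
  obtain ⟨N, hN⟩ : ∃ N, n * p = N + 2 :=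
    Nat.exists_eq_add_of_le' (hn.trans (Nat.le_mul_of_pos_right n h.pos))
  rw [← hw_eq]
  refine PieceSplit.exists_not_fullyFeasible_of_counts (hN ▸ h) hn (b₀ := n + 2) (b := fun _ => 1)
    (L := -(2 * w)) hw hnw (by rw [Fin.sum_const, smul_eq_mul]; linarith) (.inl ⟨rfl, by linarith⟩)
    fun _ => ⟨le_rfl, ?_, ?_⟩ <;> push_cast <;> linarith

theorem exists_not_fullyFeasible_of_eq_mul_add_one (h : PieceSplit m s n p (n * p + 1))
    (hn : 3 ≤ n) :
    ∃ D : MuffinSolution m s, ¬ D.FullyFeasible ∧ 1 - (m : ℝ) / s / n ≤ D.smallest := by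
  obtain ⟨w, hw_eq, hw, hnw, hle⟩ := h.exists_mul_eq_div_sub (by omega) (Nat.le_succ _)
  obtain ⟨N, hN⟩ : ∃ N, n * p = N + 2 :=
    Nat.exists_eq_add_of_le' (by nlinarith [h.pos])
  have hw' := h.lt_half_of_mul_eq (by omega) hw hnw
  have hx := h.div_lt_half
  obtain ⟨ε, hε⟩ : ∃ ε, ε = (2 * n + 1) * w - 1 := ⟨_, rfl⟩
  have hεw : |ε| ≤ w := abs_le.2 ⟨by linarith, by linarith⟩
  have hbal := isBalanced_surplusDeviations (n := n) (p := p) (N := N) (by linarith) w ε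
  have hcard : Fintype.card (Fin (p + 1) ⊕ Unit ⊕ Unit ⊕ Fin N) = s := by
    rw [← h.students, hN]
    simp only [Fintype.card_sum, Fintype.card_fin, Fintype.card_unit]
    omega
  have hdeg : ∑ i : Fin (p + 1) ⊕ Unit ⊕ Unit ⊕ Fin N,
      Sum.elim (fun _ => n) (Sum.elim (fun _ => n + 2) fun _ => n + 1) i = 2 * m := by
    rw [← h.pieces, hN]
    simp only [Fintype.sum_sum_type, Sum.elim_inl, Sum.elim_inr, Finset.sum_const,
      Finset.card_univ, Fintype.card_sum, Fintype.card_fin, Fintype.card_unit, smul_eq_mul]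
    linarith
  obtain ⟨D, ⟨e, he⟩, hsmall⟩ := hbal.exists_muffinSolution_of_partial
    (L := (m : ℝ) / s - (n + 1) / 2) (r := w) (h.muffins_pos (by omega))
    h.students_pos hcard hdeg hw hw'.le hw' (abs_le_of_mem_surplusDeviations p n N hw.le hεw)
    (by
      simp only [surplusDeviations, Sum.forall, Sum.elim_inl, Sum.elim_inr, Multiset.card_add,
        Multiset.card_replicate, Multiset.card_singleton, Multiset.sum_add, Multiset.sum_replicate,
        Multiset.sum_singleton, nsmul_eq_mul]
      push_cast
      exact ⟨fun _ => .inl ⟨trivial, hnw⟩, fun _ => .inl ⟨trivial, by linarith⟩,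
        fun _ => .inr ⟨by omega, by linarith, by linarith⟩,
        fun _ => .inr ⟨by omega, by linarith, by linarith⟩⟩)
  rw [← hw_eq]
  refine ⟨D, h.not_fullyFeasible_of_numPieces_eq (k := e.symm (.inr (.inl ()))) ?_,
    hsmall.elim id le_of_lt⟩
  rw [he, e.apply_symm_apply]
  rfl

theorem exists_not_fullyFeasible_of_mul_add_two_le (h : PieceSplit m s n p q) (hn : 2 ≤ n)
    (hpq : n * p + 2 ≤ q) :
    ∃ D : MuffinSolution m s, ¬ D.FullyFeasible ∧ 1 - (m : ℝ) / s / n ≤ D.smallest := by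
  obtain ⟨w, hw_eq, hw, hnw, hle⟩ := h.exists_mul_eq_div_sub (by omega) (by linarith)
  obtain ⟨q, rfl⟩ := Nat.exists_eq_add_of_le' (le_of_add_le_right hpq)
  have hx := h.div_lt_half
  obtain ⟨b, hsum, hb⟩ := exists_sum_eq_of_mul_le_of_le_mul (q := q) (N := n * p) (k := 0) (l := 1)
    (by simp) (by linarith)
  rw [← hw_eq]
  refine h.exists_not_fullyFeasible_of_counts hn (b₀ := n) (b := b)
    (L := 2 * ((m : ℝ) / s) - n - 1) hw hnw (by rw [hsum]; ring)
    (.inr ⟨le_rfl, by linarith, by linarith⟩) fun j => ⟨(hb j).2, ?_, ?_⟩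
  · have : 0 ≤ b j * w := by positivity
    linarith
  · have : b j * w ≤ 1 * w := by gcongr; exact_mod_cast (hb j).2
    linarith

theorem exists_not_fullyFeasible (h : PieceSplit m s n p q) (hn : 2 ≤ n) (hpq : n * p ≤ q) :
    ∃ D : MuffinSolution m s, ¬ D.FullyFeasible ∧ 1 - (m : ℝ) / s / n ≤ D.smallest := by
  obtain rfl | rfl | hpq : q = n * p ∨ q = n * p + 1 ∨ n * p + 2 ≤ q := by omega
  · exact h.exists_not_fullyFeasible_of_eq_mul hn
  · refine h.exists_not_fullyFeasible_of_eq_mul_add_one (hn.lt_of_ne ?_)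
    rintro rfl
    have := h.pieces
    omega
  · exact h.exists_not_fullyFeasible_of_mul_add_two_le hn hpq

end PieceSplit

theorem continuous_iInf_of_finite {X ι : Type*} [TopologicalSpace X] [Finite ι] [Nonempty ι]
    {f : ι → X → ℝ} (hf : ∀ i, Continuous (f i)) : Continuous fun x => ⨅ i, f i x := by
  have := Fintype.ofFinite ι
  simp only [← Finset.inf'_univ_eq_ciInf]
  exact Continuous.finset_inf'_apply _ fun i _ => hf i

namespace MuffinSolution

variable {m s : ℕ}

theorem smallest_pos (hm : 0 < m) (D : MuffinSolution m s) : 0 < D.smallest := by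
  obtain ⟨i, j, h⟩ := D.exists_size_eq_smallest hm
  exact h ▸ D.size_pos i j

theorem size_le_one_sub_smallest (D : MuffinSolution m s) (i : Fin m) (j : Fin 2) :
    D.size i j ≤ 1 - D.smallest := by
  have h := D.sum_muffin i
  rw [Fin.sum_univ_two] at h
  fin_cases j
  · exact h ▸ le_sub_iff_add_le.2 (add_le_add_right (D.smallest_le i 1) _)
  · exact h ▸ le_sub_iff_add_le'.2 (add_le_add_left (D.smallest_le i 0) _)

theorem numPieces_mul_smallest_le (D : MuffinSolution m s) (k : Fin s) :
    D.numPieces k * D.smallest ≤ (m : ℝ) / s := by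
  rw [← D.sum_student k, numPieces_mul_eq_sum]
  gcongr with i _ j
  split_ifs
  exacts [D.smallest_le i j, le_rfl]

theorem le_numPieces_mul_one_sub_smallest (D : MuffinSolution m s) (k : Fin s) :
    (m : ℝ) / s ≤ D.numPieces k * (1 - D.smallest) := by
  rw [← D.sum_student k, numPieces_mul_eq_sum]
  gcongr with i _ j
  split_ifs
  exacts [D.size_le_one_sub_smallest i j, le_rfl]

theorem sum_numPieces (D : MuffinSolution m s) : ∑ k, D.numPieces k = 2 * m := by
  unfold numPieces
  rw [← Finset.card_eq_sum_card_fiberwise fun _ _ => Finset.mem_univ _, Finset.card_univ,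
    Fintype.card_prod, Fintype.card_fin, Fintype.card_fin, mul_comm]

theorem smallest_le_of_numPieces_le (hm : 0 < m) (D : MuffinSolution m s) {k : Fin s} {v : ℝ}
    (h : (D.numPieces k : ℝ) ≤ v) (hv : 0 < v) : D.smallest ≤ 1 - (m : ℝ) / s / v := by
  have hpos : 0 ≤ 1 - D.smallest :=
    (D.size_pos ⟨0, hm⟩ 0).le.trans (D.size_le_one_sub_smallest _ _)
  rw [le_sub_comm, div_le_iff₀' hv]
  exact (D.le_numPieces_mul_one_sub_smallest k).trans (mul_le_mul_of_nonneg_right h hpos)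

theorem smallest_le_of_le_numPieces (hm : 0 < m) (D : MuffinSolution m s) {k : Fin s} {v : ℝ}
    (h : v ≤ (D.numPieces k : ℝ)) (hv : 0 < v) : D.smallest ≤ (m : ℝ) / s / v := by
  rw [le_div_iff₀' hv]
  exact (mul_le_mul_of_nonneg_right h (D.smallest_pos hm).le).trans (D.numPieces_mul_smallest_le k)

/-- The piece sizes, all at least `c`, that turn the assignment `σ` of pieces to students into a
solution. The bound `c`, positive in applications, makes this set compact. -/
def feasibleSizes (σ : Fin m → Fin 2 → Fin s) (c : ℝ) : Set (Fin m → Fin 2 → ℝ) :=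
  {z | (∀ i j, c ≤ z i j) ∧ (∀ i, ∑ j, z i j = 1) ∧
    ∀ k, (∑ i, ∑ j, if σ i j = k then z i j else 0) = (m : ℝ) / s}

theorem isCompact_feasibleSizes (σ : Fin m → Fin 2 → Fin s) {c : ℝ} :
    IsCompact (feasibleSizes σ c) := by
  refine (isCompact_univ_pi fun _ => isCompact_univ_pi fun _ =>
    isCompact_Icc (a := c) (b := 1 - c)).of_isClosed_subset ?_ fun z hz i _ j _ => ⟨hz.1 i j, ?_⟩
  · simp only [feasibleSizes, Set.ofPred_and, Set.ofPred_forall]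
    refine .inter (isClosed_iInter fun i => isClosed_iInter fun j => ?_) (.inter
      (isClosed_iInter fun i => ?_) (isClosed_iInter fun k => ?_))
    · exact isClosed_le (by fun_prop) (by fun_prop)
    · exact isClosed_eq (by fun_prop) (by fun_prop)
    · refine isClosed_eq (continuous_finsetSum _ fun i _ => continuous_finsetSum _ fun j _ => ?_)
        continuous_const
      split_ifs <;> fun_prop
  · have hsum := hz.2.1 i
    rw [Fin.sum_univ_two] at hsum
    fin_cases j
    · exact hsum ▸ le_sub_iff_add_le.2 (add_le_add_right (hz.1 i 1) _)
    · exact hsum ▸ le_sub_iff_add_le'.2 (add_le_add_left (hz.1 i 0) _)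

theorem exists_student_mem_forall_smallest_le (hm : 0 < m) {S : Set (Fin m → Fin 2 → Fin s)}
    {D₀ : MuffinSolution m s} (h₀ : D₀.student ∈ S) :
    ∃ D : MuffinSolution m s, D.student ∈ S ∧
      ∀ E : MuffinSolution m s, E.student ∈ S → E.smallest ≤ D.smallest := by
  have : Nonempty (Fin m × Fin 2) := ⟨(⟨0, hm⟩, 0)⟩
  have hmem (E : MuffinSolution m s) (hE : E.student ∈ S) (hle : D₀.smallest ≤ E.smallest) :
      E.size ∈ ⋃ σ ∈ S, feasibleSizes σ D₀.smallest :=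
    Set.mem_biUnion hE ⟨fun i j => hle.trans (E.smallest_le i j), E.sum_muffin, E.sum_student⟩
  have hcont : Continuous fun z : Fin m → Fin 2 → ℝ => ⨅ p : Fin m × Fin 2, z p.1 p.2 :=
    continuous_iInf_of_finite fun p => by fun_prop
  obtain ⟨z, hz, hmax⟩ := (S.toFinite.isCompact_biUnion fun σ _ =>
    isCompact_feasibleSizes σ).exists_isMaxOn ⟨_, hmem D₀ h₀ le_rfl⟩ hcont.continuousOn
  obtain ⟨σ, hσ, hle, hmuffin, hstudent⟩ := Set.mem_iUnion₂.1 hz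
  refine ⟨⟨z, σ, fun i j => (D₀.smallest_pos hm).trans_le (hle i j), hmuffin, hstudent⟩, hσ,
    fun E hE => ?_⟩
  rcases le_total D₀.smallest E.smallest with h | h
  · exact hmax (hmem E hE h)
  · exact h.trans (hmax (hmem D₀ h₀ le_rfl))

theorem exists_fullyOptimal (hm : 0 < m) {D₀ : MuffinSolution m s} (h₀ : D₀.FullyFeasible) :
    ∃ D : MuffinSolution m s, D.FullyOptimal := by
  obtain ⟨D, ⟨D', hD', hstudent⟩, hmax⟩ := exists_student_mem_forall_smallest_le hm
    (Set.mem_image_of_mem student (show D₀ ∈ {D | D.FullyFeasible} from h₀))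
  refine ⟨D, ?_, fun E hE => hmax E (Set.mem_image_of_mem student hE)⟩
  simpa only [Set.mem_ofPred_eq, FullyFeasible, numPieces, hstudent] using hD'

end MuffinSolution

namespace PieceSplit

variable {m s n p q : ℕ} (h : PieceSplit m s n p q)
include h

theorem smallest_le (hn : 0 < n) (E : MuffinSolution m s) :
    E.smallest ≤ 1 - (m : ℝ) / s / n := by
  obtain ⟨k, hk⟩ : ∃ k, E.numPieces k ≤ n := by
    by_contra! hk
    have hle := Finset.sum_le_sum fun k (_ : k ∈ Finset.univ) => Nat.succ_le_of_lt (hk k)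
    have hp := h.pos
    rw [E.sum_numPieces, Finset.sum_const, Finset.card_univ, Fintype.card_fin, smul_eq_mul,
      ← h.pieces, ← h.students] at hle
    linarith
  exact E.smallest_le_of_numPieces_le (h.muffins_pos hn) (by exact_mod_cast hk)
    (by exact_mod_cast hn)

theorem smallest_le_of_not_fullyFeasible (hn : 2 ≤ n) {E : MuffinSolution m s}
    (hE : ¬ E.FullyFeasible) :
    E.smallest ≤ max ((m : ℝ) / s / (n + 2)) (1 - (m : ℝ) / s / (n - 1)) := by
  have hm := h.muffins_pos (by omega)
  have hn' : (2 : ℝ) ≤ n := by exact_mod_cast hn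
  rw [h.fullyFeasible_iff] at hE
  push Not at hE
  obtain ⟨k, hk, hk'⟩ := hE
  rcases (by omega : E.numPieces k + 1 ≤ n ∨ n + 2 ≤ E.numPieces k) with hk | hk
  · refine le_max_of_le_right (E.smallest_le_of_numPieces_le (k := k) hm ?_ (by linarith))
    exact le_sub_iff_add_le.2 (by exact_mod_cast hk)
  · exact le_max_of_le_left (E.smallest_le_of_le_numPieces hm (by exact_mod_cast hk)
      (by positivity))

theorem exists_fullyFeasible_of_lt (hn : 3 ≤ n) (hlt : q < n * p) :
    ∃ D : MuffinSolution m s, D.FullyFeasible ∧ (n : ℝ) / (2 * (n + 1)) ≤ D.smallest := by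
  rcases le_total q ((n - 2) * p) with hq | hq
  · exact h.exists_fullyFeasible_of_le_sub_two_mul (by omega) hq
  rcases le_total q ((n - 1) * p) with hq' | hq'
  · exact h.exists_fullyFeasible_of_sub_two_mul_le hn hq hq'
  have hnp : n * p ≤ q * 2 :=
    calc n * p ≤ 2 * (n - 1) * p := Nat.mul_le_mul_right p (by omega)
      _ ≤ q * 2 := by linarith
  obtain ⟨D, hD, hsmall⟩ := h.exists_fullyFeasible_of_mul_le_mul le_rfl hn (by omega) hnp
  refine ⟨D, hD, hsmall.trans' ?_⟩
  have hn' : (0 : ℝ) < n := by positivity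
  have hx := h.div_lt_threshold hlt
  rw [le_sub_comm, div_le_iff₀ hn']
  refine hx.le.trans_eq ?_
  field_simp
  ring

theorem exists_fullyFeasible_forall_smallest_lt (hn : 2 ≤ n) (hlt : q < n * p) :
    ∃ D : MuffinSolution m s, D.FullyFeasible ∧
      ∀ E : MuffinSolution m s, ¬ E.FullyFeasible → E.smallest < D.smallest := by
  have hx := h.half_le_div
  rcases hn.eq_or_lt with rfl | hn3
  · obtain ⟨D, hD, hsmall⟩ := h.exists_fullyFeasible_div_four_lt hlt
    refine ⟨D, hD, fun E hE => (h.smallest_le_of_not_fullyFeasible hn hE).trans_lt ?_⟩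
    push_cast at hx ⊢
    exact max_lt (by linarith) (by linarith)
  · obtain ⟨D, hD, hsmall⟩ := h.exists_fullyFeasible_of_lt hn3 hlt
    refine ⟨D, hD, fun E hE => (h.smallest_le_of_not_fullyFeasible hn hE).trans_lt
      (hsmall.trans_lt' (max_lt ?_ ?_))⟩
    · rw [div_lt_iff₀ (by positivity)]
      refine (h.div_lt_threshold hlt).trans_eq ?_
      ring
    · have hn' : (3 : ℝ) ≤ n := by exact_mod_cast hn3
      have hn1 : (0 : ℝ) < n - 1 := by linarith
      rw [sub_lt_comm, lt_div_iff₀ hn1]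
      refine hx.trans_lt' ?_
      rw [one_sub_div (by positivity), div_mul_eq_mul_div, div_lt_iff₀ (by positivity)]
      linarith

theorem two_le (hsm : s ≤ m) : 2 ≤ n := by
  by_contra! hn
  have hle : n * p + (n + 1) * q ≤ 1 * p + 2 * q := by gcongr <;> omega
  have := h.pos
  have := h.students
  have := h.pieces
  omega

theorem exists_fullyFeasible_supplyOptimal (hn : 2 ≤ n) (hpq : n * p ≤ q) :
    ∃ D : MuffinSolution m s, D.FullyFeasible ∧ D.SupplyOptimal := by
  obtain ⟨D, hD, hsmall⟩ := h.exists_fullyFeasible_of_mul_le_mul one_le_two hn hn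
    (hpq.trans_eq (mul_one q).symm)
  exact ⟨D, hD, fun E => (h.smallest_le (by omega) E).trans hsmall⟩

theorem exists_not_fullyFeasible_supplyOptimal (hn : 2 ≤ n) (hpq : n * p ≤ q) :
    ∃ D : MuffinSolution m s, D.SupplyOptimal ∧ ¬ D.FullyFeasible := by
  obtain ⟨D, hD, hsmall⟩ := h.exists_not_fullyFeasible hn hpq
  exact ⟨D, fun E => (h.smallest_le (by omega) E).trans hsmall, hD⟩

end PieceSplit

theorem exists_pieceSplit {m s : ℕ} (hs : 0 < s) :
    ∃ p q, PieceSplit m s ⌊2 * ((m : ℝ) / s)⌋₊ p q := by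
  set n := ⌊2 * ((m : ℝ) / s)⌋₊ with hn
  have hfloor : n = 2 * m / s := by
    rw [hn, ← mul_div_assoc, ← Nat.floor_div_eq_div (K := ℝ), Nat.cast_mul, Nat.cast_two]
  have hdiv : s * n + 2 * m % s = 2 * m := hfloor ▸ Nat.div_add_mod (2 * m) s
  obtain ⟨p, hp⟩ := Nat.exists_eq_add_of_lt (Nat.mod_lt (2 * m) hs)
  refine ⟨p + 1, 2 * m % s, p.succ_pos, by omega, ?_⟩
  calc n * (p + 1) + (n + 1) * (2 * m % s)
      = (2 * m % s + p + 1) * n + 2 * m % s := by ring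
    _ = 2 * m := by rw [← hp, hdiv]

theorem mainTheorem2 (m s n : ℕ) (hs : 0 < s) (hsm : s ≤ m)
    (hn : n = ⌊2 * ((m : ℝ) / (s : ℝ))⌋₊) :
    (∀ D : MuffinSolution m s, D.FullyOptimal → D.SupplyOptimal) ∧
    (∃ D : MuffinSolution m s, D.SupplyOptimal ∧
      ∀ k, D.numPieces k = n ∨ D.numPieces k = n + 1) ∧
    ((∃ D : MuffinSolution m s, D.SupplyOptimal ∧ ¬ D.FullyFeasible) ↔
      ((n : ℝ) * ((n : ℝ) + 2) / (2 * ((n : ℝ) + 1)) ≤ (m : ℝ) / (s : ℝ) ∧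
        (m : ℝ) / (s : ℝ) < ((n : ℝ) + 1) / 2)) := by
  obtain ⟨p, q, h⟩ := exists_pieceSplit (m := m) hs
  rw [← hn] at h
  have hn2 := h.two_le hsm
  simp only [← h.fullyFeasible_iff, and_iff_left h.div_lt_half, h.threshold_le_iff]
  rcases lt_or_ge q (n * p) with hlt | hle
  · obtain ⟨D₀, hD₀, hbest⟩ := h.exists_fullyFeasible_forall_smallest_lt hn2 hlt
    have hopt (D : MuffinSolution m s) (hD : D.FullyOptimal) : D.SupplyOptimal := fun E =>
      (em E.FullyFeasible).elim (hD.2 E) fun hE => (hbest E hE).le.trans (hD.2 D₀ hD₀)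
    obtain ⟨D, hD⟩ := MuffinSolution.exists_fullyOptimal (hs.trans_le hsm) hD₀
    refine ⟨hopt, ⟨D, hopt D hD, hD.1⟩, iff_of_false ?_ hlt.not_ge⟩
    rintro ⟨E, hE, hE'⟩
    exact ((hbest E hE').trans_le (hE D₀)).false
  · obtain ⟨D₀, hD₀, hopt⟩ := h.exists_fullyFeasible_supplyOptimal hn2 hle
    exact ⟨fun D hD E => (hopt E).trans (hD.2 D₀ hD₀), ⟨D₀, hopt, hD₀⟩,
      iff_of_true (h.exists_not_fullyFeasible_supplyOptimal hn2 hle) hle⟩
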